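/- For $q\in\mathbb{C}\setminus\{0\}$ let $C(U_q(2))$ be the universal unital $C^*$-algebra generated by $a,b,D$ subject to $$ba=q\,ab,\quad a^*b=q\,ba^*,\quad bb^*=b^*b,\quad aa^*+bb^*=1,$$ $$aD=Da,\quad bD=q^2|q|^{-2}Db,\quad DD^*=D^*D=1,\quad a^*a+|q|^2b^*b=1,$$ and let $\mathcal{O}(U_q(2))$ (the underlying $*$-algebra of the Hopf $*$-algebra of the compact quantum group $U_q(2)$) be the $*$-subalgebra of $C(U_q(2))$ generated by $a,b,D$. Write $\theta=\frac1\pi\arg(q)$. (i) If $q$ is non-real, $|q|\neq 1$ and $\theta$ is irrational, then the center of $\mathcal{O}(U_q(2))$ is trivial: $\mathcal{Z}(\mathcal{O}(U_q(2)))=\mathbb{C}\cdot 1$. (ii) If $q$ is a nonzero real number, then $\mathcal{Z}(\mathcal{O}(U_q(2)))$ contains the $*$-algebra generated by $D$, this $*$-algebra is different from $\mathbb{C}\cdot 1$, and hence the center is nontrivial: $\mathcal{Z}(\mathcal{O}(U_q(2)))\neq\mathbb{C}\cdot 1$. -/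

import Mathlib

open scoped ENNReal

/-- The defining relations of the quantum unitary group `U_q(2)`, for three elements `a`, `b`, `D`
of a complex `*`-algebra. -/
structure UqTwoRel (q : ℂ) {A : Type*} [Ring A] [StarRing A] [Algebra ℂ A] (a b D : A) : Prop where
  ba : b * a = q • (a * b)
  star_a_b : star a * b = q • (b * star a)
  b_normal : b * star b = star b * b
  row : a * star a + b * star b = 1
  a_D : a * D = D * a
  b_D : b * D = (q ^ 2 * ((‖q‖ : ℂ) ^ 2)⁻¹) • (D * b)
  D_star : D * star D = 1
  star_D : star D * D = 1
  col : star a * a + ((‖q‖ : ℂ) ^ 2) • (star b * b) = 1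

/-- A realisation of the relations in some nonzero unital `C*`-algebra. Every unital `C*`-algebra
generated by three elements is separable, hence is isomorphic to one living in `Type`, so no
realisation is lost by this choice of universe. -/
structure UqTwoRep (q : ℂ) : Type 1 where
  carrier : Type
  [cstar : CStarAlgebra carrier]
  [nontriv : Nontrivial carrier]
  a : carrier
  b : carrier
  D : carrier
  rel : UqTwoRel q a b D

attribute [instance] UqTwoRep.cstar UqTwoRep.nontriv

theorem UqTwoRel.norm_le_one {A : Type*} [CStarAlgebra A] {x y : A}
    (h : x * star x + y * star y = 1) : ‖x‖ ≤ 1 := by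
  let _ : PartialOrder A := CStarAlgebra.spectralOrder A
  have _ : StarOrderedRing A := CStarAlgebra.spectralOrderedRing A
  have h1 : x * star x ≤ 1 := by
    rw [← h]; exact le_add_of_nonneg_right (mul_star_self_nonneg y)
  have h2 : ‖x * star x‖ ≤ 1 :=
    (CStarAlgebra.norm_le_one_iff_of_nonneg _ (mul_star_self_nonneg x)).2 h1
  rw [CStarRing.norm_self_mul_star] at h2
  nlinarith [norm_nonneg x]

namespace UqTwo

variable (q : ℂ)

/-- The `ℓ^∞`-product of the `C*`-algebras carrying the realisations of the relations. -/
abbrev Ambient : Type 1 := lp (fun π : UqTwoRep q => π.carrier) ∞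

theorem memlp_of_norm_le_one (f : ∀ π : UqTwoRep q, π.carrier) (h : ∀ π, ‖f π‖ ≤ 1) :
    Memℓp f ∞ :=
  memℓp_infty ⟨1, by rintro _ ⟨π, rfl⟩; exact h π⟩

noncomputable section

/-- The universal realisation: in the coordinate of a realisation `π`, the universal `a`, `b`, `D`
are those of `π`. -/
def a₀ : Ambient q :=
  ⟨fun π => π.a, memlp_of_norm_le_one q _ fun π => UqTwoRel.norm_le_one π.rel.row⟩

def b₀ : Ambient q :=
  ⟨fun π => π.b, memlp_of_norm_le_one q _ fun π =>
    UqTwoRel.norm_le_one ((add_comm _ _).trans π.rel.row)⟩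

def D₀ : Ambient q :=
  ⟨fun π => π.D, memlp_of_norm_le_one q _ fun π =>
    UqTwoRel.norm_le_one (y := 0) (by simpa using π.rel.D_star)⟩

/-- `C(U_q(2))`, the universal unital `C*`-algebra generated by `a`, `b`, `D` subject to the
relations: the closed `*`-algebra generated by the universal realisation. The norm of a
`*`-polynomial in the generators is the supremum of its norms in all realisations. -/
def CU : StarSubalgebra ℂ (Ambient q) :=
  (StarAlgebra.adjoin ℂ {a₀ q, b₀ q, D₀ q}).topologicalClosure

theorem generators_subset : ({a₀ q, b₀ q, D₀ q} : Set (Ambient q)) ⊆ CU q :=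
  (StarAlgebra.subset_adjoin ℂ _).trans (StarSubalgebra.le_topologicalClosure _)

def a : CU q := ⟨a₀ q, generators_subset q (by simp)⟩

def b : CU q := ⟨b₀ q, generators_subset q (by simp)⟩

def D : CU q := ⟨D₀ q, generators_subset q (by simp)⟩

/-- `𝒪(U_q(2))`, the `*`-subalgebra of `C(U_q(2))` generated by `a`, `b`, `D`. -/
def O : StarSubalgebra ℂ (CU q) := StarAlgebra.adjoin ℂ {a q, b q, D q}

/-- The generator `D` as an element of `𝒪(U_q(2))`. -/
def DO : O q := ⟨D q, StarAlgebra.subset_adjoin ℂ _ (by simp)⟩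

/-- The generators satisfy the defining relations. -/
theorem rel : UqTwoRel q (a q) (b q) (D q) where
  ba := Subtype.ext (Subtype.ext (funext fun π => π.rel.ba))
  star_a_b := Subtype.ext (Subtype.ext (funext fun π => π.rel.star_a_b))
  b_normal := Subtype.ext (Subtype.ext (funext fun π => π.rel.b_normal))
  row := Subtype.ext (Subtype.ext (funext fun π => π.rel.row))
  a_D := Subtype.ext (Subtype.ext (funext fun π => π.rel.a_D))
  b_D := Subtype.ext (Subtype.ext (funext fun π => π.rel.b_D))
  D_star := Subtype.ext (Subtype.ext (funext fun π => π.rel.D_star))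
  star_D := Subtype.ext (Subtype.ext (funext fun π => π.rel.star_D))
  col := Subtype.ext (Subtype.ext (funext fun π => π.rel.col))

/-- The `*`-homomorphism from `C(U_q(2))` to a realisation which the universal property asks for. -/
def toRep (π : UqTwoRep q) : CU q →⋆ₐ[ℂ] π.carrier where
  toFun x := (x : Ambient q) π
  map_one' := rfl
  map_mul' _ _ := rfl
  map_zero' := rfl
  map_add' _ _ := rfl
  commutes' _ := rfl
  map_star' _ := rfl

theorem toRep_generators (π : UqTwoRep q) :
    toRep q π (a q) = π.a ∧ toRep q π (b q) = π.b ∧ toRep q π (D q) = π.D :=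
  ⟨rfl, rfl, rfl⟩

/-- `C(U_q(2))` is a `C*`-algebra. -/
abbrev cstarAlgebra : CStarAlgebra (CU q) :=
  letI : CStarAlgebra (Ambient q) := { }
  haveI : IsClosed ((CU q : StarSubalgebra ℂ (Ambient q)) : Set (Ambient q)) :=
    StarSubalgebra.isClosed_topologicalClosure _
  StarSubalgebra.cstarAlgebra (CU q)

/-- A `*`-homomorphism from `C(U_q(2))` to a `C*`-algebra is determined by the images of the
generators. -/
theorem hom_ext {B : Type*} [CStarAlgebra B] {φ ψ : CU q →⋆ₐ[ℂ] B}
    (ha : φ (a q) = ψ (a q)) (hb : φ (b q) = ψ (b q)) (hD : φ (D q) = ψ (D q)) : φ = ψ := by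
  have key : ∀ (A : Type 1) [CStarAlgebra A] (χ : A →⋆ₐ[ℂ] B), Continuous χ :=
    fun _ _ χ => AddMonoidHomClass.continuous_of_bound χ 1 fun x => by
      simpa only [one_mul] using NonUnitalStarAlgHom.norm_apply_le χ x
  have hc : ∀ χ : CU q →⋆ₐ[ℂ] B, Continuous χ := fun χ => @key (CU q) (cstarAlgebra q) χ
  refine StarAlgHom.ext_topologicalClosure (hc φ) (hc ψ) ?_
  refine StarAlgHom.ext_adjoin ?_
  rintro ⟨x, hx⟩ h
  simp only [Set.mem_insert_iff, Set.mem_singleton_iff] at h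
  rcases h with h | h | h
  all_goals subst h; assumption

end

end UqTwo

/-! The generators and their adjoints commute up to scalars, except that `a a*` and `a* a` are
polynomials in `b b*`. Hence the ordered monomials b^m b*^k a^n D^l (m, k natural; n, l integers;
negative powers meaning powers of the adjoint) span the `*`-algebra.

For 0 < |q| < 1 they are linearly independent when the phase q²/|q|² is not a root of unity. On ℓ²(ℕ
× ℤ), a^n D^l moves basis vectors by (n, l) and b is diagonal, so matrix coefficients isolate each
pair (n, l). Along the levels t, what remains is a combination of geometric sequences with the
distinct ratios q^m q̄^k (`linearIndependent_mono_op`).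

Now expand a central element. Commuting with b forces q^n phase^l = 1 on the support, so n = 0 by
taking norms and then l = 0. Commuting with a forces q^m q̄^k = 1, so m = k = 0 and the element is
scalar (`UqTwoRel.mem_range_algebraMap_of_commute`). The case |q| > 1 reduces to this one through
(a*, q b, D*), which satisfies the relations for q⁻¹ (`UqTwoRel.inv`).

For real q the phase is 1, so D is central. It is not scalar, because D takes the values 1 and -1 in
one-dimensional realisations. -/

/-- Integer powers with a prescribed partner `v` in place of the inverse of `u`. -/
def ipow {A : Type*} [Monoid A] (u v : A) : ℤ → A
  | Int.ofNat n => u ^ n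
  | Int.negSucc n => v ^ (n + 1)

section ipow

theorem ipow_zero {A : Type*} [Monoid A] (u v : A) : ipow u v 0 = 1 := pow_zero u

theorem ipow_one {A : Type*} [Monoid A] (u v : A) : ipow u v 1 = u := pow_one u

theorem mul_ipow_of_nonneg {A : Type*} [Monoid A] (u v : A) {n : ℤ} (hn : 0 ≤ n) :
    u * ipow u v n = ipow u v (n + 1) := by
  obtain ⟨n, rfl⟩ := Int.eq_ofNat_of_zero_le hn
  exact (pow_succ' u n).symm

theorem ipow_neg {A : Type*} [Monoid A] (u v : A) (n : ℤ) : ipow u v (-n) = ipow v u n := by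
  rcases n with (_ | n) | n
  · change u ^ 0 = v ^ 0
    simp
  · rfl
  · rfl

theorem mul_ipow_of_neg {A : Type*} [Monoid A] (u v : A) {n : ℤ} (hn : n < 0) :
    u * ipow u v n = u * v * ipow u v (n + 1) := by
  obtain ⟨m, rfl⟩ : ∃ m : ℤ, n = -(m + 1) := ⟨-n - 1, by ring⟩
  rw [show -(m + 1) + 1 = -m by ring, ipow_neg, ipow_neg, ← mul_ipow_of_nonneg v u (by omega),
    mul_assoc]

theorem map_ipow {A B F : Type*} [Monoid A] [Monoid B] [FunLike F A B] [MonoidHomClass F A B]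
    (f : F) (u v : A) (n : ℤ) : f (ipow u v n) = ipow (f u) (f v) n := by
  rcases n with n | n
  · exact map_pow f u n
  · exact map_pow f v (n + 1)

end ipow

/-! ### Commutation up to a scalar. -/

section twistedCommutation

variable {A : Type*} [Ring A] [Algebra ℂ A]

theorem mul_mul_eq_smul {u v w : A} {c d : ℂ} (hv : u * v = c • (v * u))
    (hw : u * w = d • (w * u)) : u * (v * w) = (c * d) • (v * w * u) := by
  rw [← mul_assoc, hv, smul_mul_assoc, mul_assoc, hw, mul_smul_comm, smul_smul, mul_assoc]

theorem mul_pow_eq_smul {u v : A} {c : ℂ} (h : u * v = c • (v * u)) (n : ℕ) :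
    u * v ^ n = c ^ n • (v ^ n * u) := by
  induction n with
  | zero => simp
  | succ n ih => rw [pow_succ, mul_mul_eq_smul ih h, pow_succ]

theorem pow_mul_eq_smul {u v : A} {c : ℂ} (h : u * v = c • (v * u)) (n : ℕ) :
    u ^ n * v = c ^ n • (v * u ^ n) := by
  induction n with
  | zero => simp
  | succ n ih =>
    rw [pow_succ, mul_assoc, h, mul_smul_comm, ← mul_assoc, ih, smul_mul_assoc, smul_smul,
      mul_assoc, pow_succ, mul_comm c]

theorem eq_inv_smul_mul {u v : A} {c : ℂ} (hc : c ≠ 0) (h : u * v = c • (v * u)) :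
    v * u = c⁻¹ • (u * v) := by
  rw [h, smul_smul, inv_mul_cancel₀ hc, one_smul]

theorem ipow_mul_eq_smul {u v w : A} {c : ℂ} (hu : u * w = c • (w * u))
    (hv : v * w = c⁻¹ • (w * v)) (n : ℤ) : ipow u v n * w = c ^ n • (w * ipow u v n) := by
  rcases n with n | n
  · rw [Int.ofNat_eq_natCast, zpow_natCast]
    exact pow_mul_eq_smul hu n
  · simpa [ipow, zpow_negSucc] using pow_mul_eq_smul hv (n + 1)

end twistedCommutation

/-! ### Coefficient comparison. -/

/-- Geometric sequences with distinct ratios are linearly independent. -/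
theorem eq_zero_of_forall_sum_mul_pow_eq_zero {ι : Type*} {s : Finset ι} {z c : ι → ℂ}
    (hz : Set.InjOn z s) (h : ∀ n : ℕ, ∑ i ∈ s, c i * z i ^ n = 0) {i : ι} (hi : i ∈ s) :
    c i = 0 := by
  classical
  have hp : ∀ p : Polynomial ℂ, ∑ j ∈ s, c j * p.eval (z j) = 0 := by
    intro p
    simp_rw [Polynomial.eval_eq_sum_range, Finset.mul_sum]
    rw [Finset.sum_comm]
    refine Finset.sum_eq_zero fun n _ => ?_
    have := congrArg (p.coeff n * ·) (h n)
    simp only [Finset.mul_sum, mul_zero] at this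
    rw [← this]
    exact Finset.sum_congr rfl fun j _ => by ring
  -- This polynomial vanishes at every ratio except `z i`, so it isolates the coefficient `c i`.
  have h1 := hp (∏ j ∈ s.erase i, (Polynomial.X - Polynomial.C (z j)))
  rw [Finset.sum_eq_single_of_mem i hi] at h1
  · refine (mul_eq_zero.1 h1).resolve_right ?_
    rw [Polynomial.eval_prod, ← ne_eq, Finset.prod_ne_zero_iff]
    intro j hj
    obtain ⟨hji, hj⟩ := Finset.mem_erase.1 hj
    simpa [sub_ne_zero] using fun e => hji (hz hi hj e).symm
  · intro j hj hji
    rw [Polynomial.eval_prod, Finset.prod_eq_zero (Finset.mem_erase.2 ⟨hji, hj⟩) (by simp),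
      mul_zero]

/-- If an element commutes with `u` and `u` acts on the monomials in its expansion from either side
by scalars and the same shift, then the scalars agree on the support of the expansion. -/
theorem LinearIndependent.eq_of_commute {A ι : Type*} [Ring A] [Algebra ℂ A] {M : ι → A}
    (hM : LinearIndependent ℂ M) {c : ι →₀ ℂ} {u : A} {ρ : ι → ι} (hρ : Function.Injective ρ)
    {l r : ι → ℂ} (hl : ∀ i ∈ c.support, u * M i = l i • M (ρ i))
    (hr : ∀ i ∈ c.support, M i * u = r i • M (ρ i))
    (hu : Commute (Finsupp.linearCombination ℂ M c) u) {i : ι} (hi : i ∈ c.support) :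
    l i = r i := by
  have h := hu.eq
  rw [Finsupp.linearCombination_apply, Finsupp.sum, Finset.sum_mul, Finset.mul_sum] at h
  have h2 : ∑ j ∈ c.support, (c j * (l j - r j)) • M (ρ j) = 0 := by
    rw [← sub_eq_zero.2 h.symm, ← Finset.sum_sub_distrib]
    refine Finset.sum_congr rfl fun j hj => ?_
    rw [mul_smul_comm, smul_mul_assoc, hl j hj, hr j hj, smul_smul, smul_smul, ← sub_smul, mul_sub]
  have h3 := linearIndependent_iff'.1 (hM.comp ρ hρ) c.support _ h2 i hi
  exact sub_eq_zero.1 ((mul_eq_zero.1 h3).resolve_left (Finsupp.mem_support_iff.1 hi))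

/-! ### Weighted composition operators on ℓ² and their adjoints. -/

section weightedComposition

variable {ι : Type*}

/-- Terms of weight zero drop out and the others reindex injectively into a partial sum for `x`.
Injectivity is asked only off the zeros of `w`, so that a truncated shift qualifies. -/
theorem sum_norm_mul_comp_sq_le {w : ι → ℂ} {σ : ι → ι} (hw : ∀ i, ‖w i‖ ≤ 1)
    (hσ : Set.InjOn σ {i | w i ≠ 0}) (x : lp (fun _ : ι => ℂ) 2) (s : Finset ι) :
    ∑ i ∈ s, ‖w i * x (σ i)‖ ^ (2 : ℝ≥0∞).toReal ≤ ‖x‖ ^ (2 : ℝ≥0∞).toReal := by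
  classical
  have h2 : 0 < (2 : ℝ≥0∞).toReal := by norm_num
  calc ∑ i ∈ s, ‖w i * x (σ i)‖ ^ (2 : ℝ≥0∞).toReal
      = ∑ i ∈ s with w i ≠ 0, ‖w i * x (σ i)‖ ^ (2 : ℝ≥0∞).toReal := by
        rw [Finset.sum_filter_of_ne]
        intro i _ h hi
        simp [hi] at h
    _ ≤ ∑ i ∈ s with w i ≠ 0, ‖x (σ i)‖ ^ (2 : ℝ≥0∞).toReal := by
        refine Finset.sum_le_sum fun i _ => Real.rpow_le_rpow (norm_nonneg _) ?_ h2.le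
        rw [norm_mul]
        exact mul_le_of_le_one_left (norm_nonneg _) (hw i)
    _ = ∑ j ∈ (s.filter fun i => w i ≠ 0).image σ, ‖x j‖ ^ (2 : ℝ≥0∞).toReal := by
        rw [Finset.sum_image]
        intro i hi j hj
        exact hσ (by simpa using (Finset.mem_filter.1 hi).2) (by simpa using (Finset.mem_filter.1 hj).2)
    _ ≤ ‖x‖ ^ (2 : ℝ≥0∞).toReal := lp.sum_rpow_le_norm_rpow h2 x _

/-- The weighted composition operator `x ↦ (i ↦ w i * x (σ i))` on `ℓ²`. -/
noncomputable def weightedComp (w : ι → ℂ) (σ : ι → ι) (hw : ∀ i, ‖w i‖ ≤ 1)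
    (hσ : Set.InjOn σ {i | w i ≠ 0}) :
    lp (fun _ : ι => ℂ) 2 →L[ℂ] lp (fun _ : ι => ℂ) 2 :=
  LinearMap.mkContinuous
    { toFun := fun x => ⟨fun i => w i * x (σ i), memℓp_gen' (sum_norm_mul_comp_sq_le hw hσ x)⟩
      map_add' := fun x y => by
        ext i
        simp only [lp.coeFn_add, Pi.add_apply, mul_add]
      map_smul' := fun c x => by
        ext i
        simp [mul_left_comm] } 1 fun x => by
    rw [one_mul]
    exact lp.norm_le_of_forall_sum_le (by norm_num) (norm_nonneg x)
      (sum_norm_mul_comp_sq_le hw hσ x)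

@[simp]
theorem weightedComp_apply (w : ι → ℂ) (σ : ι → ι) (hw : ∀ i, ‖w i‖ ≤ 1)
    (hσ : Set.InjOn σ {i | w i ≠ 0}) (x : lp (fun _ : ι => ℂ) 2) (i : ι) :
    weightedComp w σ hw hσ x i = w i * x (σ i) := rfl

/-- The hypothesis says that the two matrices are conjugate transposes of each other. It determines
the operator on basis vectors, and pairing with these gives the coordinates of the adjoint. -/
theorem star_weightedComp [DecidableEq ι] {w w' : ι → ℂ} {σ σ' : ι → ι} {hw : ∀ i, ‖w i‖ ≤ 1}
    {hσ : Set.InjOn σ {i | w i ≠ 0}} {hw' : ∀ i, ‖w' i‖ ≤ 1}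
    {hσ' : Set.InjOn σ' {i | w' i ≠ 0}}
    (h : ∀ i j, (if σ j = i then w j else 0) = if σ' i = j then star (w' i) else 0) :
    star (weightedComp w σ hw hσ) = weightedComp w' σ' hw' hσ' := by
  ext x i
  have h1 : weightedComp w σ hw hσ (lp.single 2 i 1) = lp.single 2 (σ' i) (star (w' i)) := by
    ext j
    have := h i j
    rw [weightedComp_apply]
    simp only [lp.single_apply, Pi.single_apply]
    rw [mul_ite, mul_one, mul_zero, this]
    simp only [eq_comm]
  have h2 := lp.inner_single_left (𝕜 := ℂ) i (1 : ℂ) (star (weightedComp w σ hw hσ) x)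
  rw [ContinuousLinearMap.star_eq_adjoint, ContinuousLinearMap.adjoint_inner_right, h1,
    lp.inner_single_left] at h2
  simp only [RCLike.inner_apply, map_one, mul_one] at h2
  rw [ContinuousLinearMap.star_eq_adjoint, ← h2, weightedComp_apply]
  simp [mul_comm]

end weightedComposition

/-! ### The phase of q and the ratios q^m q̄^k. -/

namespace UqTwo

/-- The commutation phase `q² / |q|²` of `b` and `D`. -/
noncomputable def phase (q : ℂ) : ℂ := q ^ 2 * ((‖q‖ : ℂ) ^ 2)⁻¹

variable {q : ℂ}

theorem phase_mul_conj (hq : q ≠ 0) : phase q * star q = q := by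
  have h : (‖q‖ : ℂ) ^ 2 = q * star q := (Complex.mul_conj' q).symm
  have h' : star q ≠ 0 := star_ne_zero.2 hq
  rw [phase, h]
  field_simp

theorem norm_phase (hq : q ≠ 0) : ‖phase q‖ = 1 := by
  have h := congrArg norm (phase_mul_conj hq)
  rw [norm_mul, norm_star] at h
  exact mul_right_cancel₀ (norm_ne_zero_iff.2 hq) (by rw [h, one_mul])

theorem phase_ne_zero (hq : q ≠ 0) : phase q ≠ 0 :=
  norm_ne_zero_iff.1 (by rw [norm_phase hq]; exact one_ne_zero)

theorem star_phase (hq : q ≠ 0) : star (phase q) = (phase q)⁻¹ :=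
  (Complex.inv_eq_conj (norm_phase hq)).symm

theorem phase_inv (q : ℂ) : phase q⁻¹ = (phase q)⁻¹ := by
  simp [phase, mul_comm]

theorem phase_ofReal {q : ℝ} (hq : q ≠ 0) : phase (q : ℂ) = 1 := by
  have h : (q : ℂ) ≠ 0 := by exact_mod_cast hq
  have := phase_mul_conj h
  rw [Complex.star_def, Complex.conj_ofReal] at this
  exact mul_right_cancel₀ h (by rw [this, one_mul])

/-- The phase is exp(2i arg q), so a nonzero l would make arg q a rational multiple of π. -/
theorem phase_zpow_eq_one (hq : q ≠ 0) (hθ : Irrational (Complex.arg q / Real.pi)) {l : ℤ}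
    (h : phase q ^ l = 1) : l = 0 := by
  by_contra hl
  have hpi := Real.pi_ne_zero
  have hq' : (‖q‖ : ℂ) ≠ 0 := by exact_mod_cast norm_ne_zero_iff.2 hq
  have h1 : phase q = Complex.exp (2 * (q.arg * Complex.I)) := by
    rw [two_mul, Complex.exp_add, phase]
    nth_rewrite 1 [← Complex.norm_mul_exp_arg_mul_I q]
    field_simp
  rw [h1, ← Complex.exp_int_mul, Complex.exp_eq_one_iff] at h
  obtain ⟨k, hk⟩ := h
  have h2 : (l : ℂ) * q.arg = k * Real.pi := by
    have hI : (2 * Complex.I) ≠ 0 := by simp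
    refine mul_right_cancel₀ hI ?_
    linear_combination hk
  have h3 : (l : ℝ) * q.arg = k * Real.pi := by exact_mod_cast h2
  have hl' : (l : ℝ) ≠ 0 := by exact_mod_cast hl
  refine hθ ⟨(k : ℚ) / l, ?_⟩
  push_cast
  field_simp
  linarith

/-- The modulus determines m + k. Since q = phase · q̄, the value is phase^m q̄^(m+k), which then
determines m. -/
theorem injective_pow_mul_conj_pow (hq0 : q ≠ 0) (hq1 : ‖q‖ ≠ 1)
    (hω : ∀ l : ℤ, phase q ^ l = 1 → l = 0) :
    Function.Injective fun p : ℕ × ℕ => q ^ p.1 * star q ^ p.2 := by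
  rintro ⟨m, k⟩ ⟨m', k'⟩ h
  have hn : 0 < ‖q‖ := norm_pos_iff.2 hq0
  have hs : star q ≠ 0 := star_ne_zero.2 hq0
  dsimp only at h
  have h1 := congrArg norm h
  simp only [norm_mul, norm_pow, norm_star, ← pow_add] at h1
  have h2 : m + k = m' + k' := pow_right_injective₀ hn hq1 h1
  have key : ∀ i j : ℕ, q ^ i * star q ^ j = phase q ^ i * star q ^ (i + j) := by
    intro i j
    nth_rewrite 1 [← phase_mul_conj hq0]
    ring
  rw [key, key, h2] at h
  have h3 := mul_right_cancel₀ (pow_ne_zero _ hs) h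
  have h4 : phase q ^ ((m : ℤ) - m') = 1 := by
    rw [zpow_sub₀ (phase_ne_zero hq0), zpow_natCast, zpow_natCast, h3,
      div_self (pow_ne_zero _ (phase_ne_zero hq0))]
  have h5 := hω _ h4
  ext <;> simp <;> omega

end UqTwo

/-! ### Ordered monomials. -/

namespace UqTwo

theorem eq_of_mem_union_star {A : Type*} [InvolutiveStar A] {a b c u : A}
    (h : u ∈ ({a, b, c} : Set A) ∪ star {a, b, c}) :
    u = a ∨ u = b ∨ u = c ∨ u = star a ∨ u = star b ∨ u = star c := by
  rcases h with h | h
  · simp only [Set.mem_insert_iff, Set.mem_singleton_iff] at h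
    tauto
  · simp only [Set.mem_star, Set.mem_insert_iff, Set.mem_singleton_iff, star_eq_iff_star_eq] at h
    simp only [eq_comm (a := u)] at h ⊢
    tauto

/-- The ordered monomials in the generators, indexed by `((m, k), n, l)`. -/
def mono {A : Type*} [Monoid A] [Star A] (a b D : A) (p : (ℕ × ℕ) × ℤ × ℤ) : A :=
  b ^ p.1.1 * star b ^ p.1.2 * (ipow a (star a) p.2.1 * ipow D (star D) p.2.2)

theorem map_mono {A B : Type*} [Monoid A] [Star A] [Monoid B] [Star B] {F : Type*} [FunLike F A B]
    [MonoidHomClass F A B] [StarHomClass F A B] (f : F) (a b D : A) (p : (ℕ × ℕ) × ℤ × ℤ) :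
    f (mono a b D p) = mono (f a) (f b) (f D) p := by
  simp [mono, map_ipow, map_star]

theorem b_mul_mono {A : Type*} [Monoid A] [Star A] (a b D : A) (m k : ℕ) (n l : ℤ) :
    b * mono a b D ((m, k), n, l) = mono a b D ((m + 1, k), n, l) := by
  simp only [mono, pow_succ', mul_assoc]

theorem mono_mul_a {A : Type*} [Monoid A] [Star A] (a b D : A) (m k : ℕ) :
    mono a b D ((m, k), 0, 0) * a = mono a b D ((m, k), 1, 0) := by
  simp [mono, ipow_zero, ipow_one]

end UqTwo

/-! ### Consequences of the relations: spanning and commutants. -/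

namespace UqTwoRel

open UqTwo

variable {q : ℂ} {A : Type*} [Ring A] [StarRing A] [Algebra ℂ A] {a b D : A}

theorem a_b (h : UqTwoRel q a b D) (hq : q ≠ 0) : a * b = q⁻¹ • (b * a) :=
  eq_inv_smul_mul hq h.ba

theorem D_b (h : UqTwoRel q a b D) (hq : q ≠ 0) : D * b = (phase q)⁻¹ • (b * D) :=
  eq_inv_smul_mul (phase_ne_zero hq) h.b_D

theorem star_D_b (h : UqTwoRel q a b D) : star D * b = phase q • (b * star D) := by
  calc star D * b = star D * (b * D) * star D := by rw [mul_assoc, mul_assoc, h.D_star, mul_one]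
    _ = phase q • (b * star D) := by
      rw [h.b_D, mul_smul_comm, ← mul_assoc, h.star_D, one_mul, smul_mul_assoc]
      rfl

theorem D_star_a (h : UqTwoRel q a b D) : D * star a = star a * D := by
  have h1 : star D * a = a * star D := by
    calc star D * a = star D * (a * D) * star D := by rw [mul_assoc, mul_assoc, h.D_star, mul_one]
      _ = a * star D := by rw [h.a_D, ← mul_assoc, h.star_D, one_mul]
  simpa using (congrArg star h1).symm

theorem star_a_mul_self (h : UqTwoRel q a b D) :
    star a * a = 1 - ((‖q‖ : ℂ) ^ 2) • (star b * b) := eq_sub_of_add_eq h.col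

theorem a_mul_star_self (h : UqTwoRel q a b D) : a * star a = 1 - b * star b :=
  eq_sub_of_add_eq h.row

theorem star_b_mul_mono (h : UqTwoRel q a b D) (m k : ℕ) (n l : ℤ) :
    star b * mono a b D ((m, k), n, l) = mono a b D ((m, k + 1), n, l) := by
  have h1 : Commute (star b) (b ^ m) := (show Commute (star b) b from h.b_normal.symm).pow_right m
  simp only [mono, pow_succ', ← mul_assoc]
  rw [h1.eq]

/-- A letter passes the powers of `b` and `star b` at the cost of a scalar, so only its product with
the remaining factor matters. -/
theorem mul_mono_mem {u : A} {c d : ℂ} (hb : u * b = c • (b * u))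
    (hs : u * star b = d • (star b * u)) (P : Submodule ℂ A) (m k : ℕ) (n l : ℤ)
    (hP : b ^ m * star b ^ k * (u * (ipow a (star a) n * ipow D (star D) l)) ∈ P) :
    u * mono a b D ((m, k), n, l) ∈ P := by
  rw [mono, ← mul_assoc, mul_mul_eq_smul (mul_pow_eq_smul hb m) (mul_pow_eq_smul hs k),
    smul_mul_assoc, mul_assoc]
  exact P.smul_mem _ hP

theorem pow_mul_pow_mul (h : UqTwoRel q a b D) (m k : ℕ) (x : A) :
    b ^ m * star b ^ k * (b * star b * x) = b ^ (m + 1) * star b ^ (k + 1) * x := by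
  have h1 : Commute (star b ^ k) b := (show Commute (star b) b from h.b_normal.symm).pow_left k
  simp only [pow_succ, mul_assoc]
  rw [← mul_assoc (star b ^ k) b, h1.eq]
  simp only [mul_assoc]

theorem mono_mul_b (h : UqTwoRel q a b D) (hq : q ≠ 0) (m k : ℕ) (n l : ℤ) :
    mono a b D ((m, k), n, l) * b =
      ((q ^ n)⁻¹ * (phase q ^ l)⁻¹) • mono a b D ((m + 1, k), n, l) := by
  have h1 : Commute (star b ^ k) b := (show Commute (star b) b from h.b_normal.symm).pow_left k
  have ha : ipow a (star a) n * b = (q ^ n)⁻¹ • (b * ipow a (star a) n) := by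
    rw [← inv_zpow]
    exact ipow_mul_eq_smul (h.a_b hq) (by rw [inv_inv]; exact h.star_a_b) n
  have hD : ipow D (star D) l * b = (phase q ^ l)⁻¹ • (b * ipow D (star D) l) := by
    rw [← inv_zpow]
    exact ipow_mul_eq_smul (h.D_b hq) (by rw [inv_inv]; exact h.star_D_b) l
  simp only [mono, mul_assoc]
  rw [hD, mul_smul_comm, ← mul_assoc (ipow a (star a) n), ha]
  simp only [mul_smul_comm, smul_mul_assoc, smul_smul, pow_succ, mul_assoc]
  rw [← mul_assoc (star b ^ k) b, h1.eq, mul_comm (phase q ^ l)⁻¹]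
  simp only [mul_assoc]

variable [StarModule ℂ A]

theorem star_a_star_b (h : UqTwoRel q a b D) : star a * star b = star q • (star b * star a) := by
  simpa using congrArg star h.ba

theorem a_star_b (h : UqTwoRel q a b D) (hq : q ≠ 0) : a * star b = (star q)⁻¹ • (star b * a) :=
  eq_inv_smul_mul (star_ne_zero.2 hq) (by simpa using congrArg star h.star_a_b)

theorem D_star_b (h : UqTwoRel q a b D) (hq : q ≠ 0) : D * star b = phase q • (star b * D) := by
  have := congrArg star h.star_D_b
  rw [star_mul, star_smul, star_mul, star_star, star_phase hq] at this
  rw [this, smul_smul, mul_inv_cancel₀ (phase_ne_zero hq), one_smul]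

theorem star_D_star_b (h : UqTwoRel q a b D) (hq : q ≠ 0) :
    star D * star b = (phase q)⁻¹ • (star b * star D) := by
  have : star D * star b = star (phase q) • (star b * star D) := by
    rw [← star_mul, ← star_mul, ← star_smul]
    exact congrArg star h.b_D
  rw [this, star_phase hq]

theorem a_mul_mono_zero (h : UqTwoRel q a b D) (hq : q ≠ 0) (m k : ℕ) :
    a * mono a b D ((m, k), 0, 0) = (q ^ m * star q ^ k)⁻¹ • mono a b D ((m, k), 1, 0) := by
  rw [← mono_mul_a a b D]
  simp only [mono, ipow_zero, mul_one]
  rw [mul_mul_eq_smul (mul_pow_eq_smul (h.a_b hq) m) (mul_pow_eq_smul (h.a_star_b hq) k),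
    inv_pow, inv_pow, mul_inv]

/-- Each letter is moved to its place in the ordered monomial. Only `a` meeting `star a` does more
than shift an exponent: it leaves a polynomial in `b * star b`, absorbed by raising both m and k. -/
theorem mul_mono_mem_span (h : UqTwoRel q a b D) (hq : q ≠ 0) {u : A}
    (hu : u ∈ ({a, b, D} : Set A) ∪ star {a, b, D}) (p : (ℕ × ℕ) × ℤ × ℤ) :
    u * mono a b D p ∈ Submodule.span ℂ (Set.range (mono a b D)) := by
  obtain ⟨⟨m, k⟩, n, l⟩ := p
  have hmem : ∀ p, mono a b D p ∈ Submodule.span ℂ (Set.range (mono a b D)) :=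
    fun p => Submodule.subset_span ⟨p, rfl⟩
  rcases eq_of_mem_union_star hu with rfl | rfl | rfl | rfl | rfl | rfl
  · refine mul_mono_mem (h.a_b hq) (h.a_star_b hq) _ m k n l ?_
    rw [← mul_assoc u]
    rcases le_or_gt 0 n with hn | hn
    · rw [mul_ipow_of_nonneg _ _ hn]
      exact hmem ((m, k), n + 1, l)
    · rw [mul_ipow_of_neg _ _ hn, h.a_mul_star_self, sub_mul, sub_mul, one_mul, mul_sub,
        mul_assoc (b * star b),
        h.pow_mul_pow_mul]
      exact sub_mem (hmem ((m, k), n + 1, l)) (hmem ((m + 1, k + 1), n + 1, l))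
  · rw [b_mul_mono]
    exact hmem _
  · refine mul_mono_mem (h.D_b hq) (h.D_star_b hq) _ m k n l ?_
    have h1 : u * ipow a (star a) n = ipow a (star a) n * u := by
      have := ipow_mul_eq_smul (c := 1) (u := a) (v := star a) (w := u) (by rw [one_smul]; exact h.a_D)
        (by rw [inv_one, one_smul]; exact h.D_star_a.symm) n
      rw [this, one_zpow, one_smul]
    rw [← mul_assoc u, h1, mul_assoc (ipow a (star a) n)]
    rcases le_or_gt 0 l with hl | hl
    · rw [mul_ipow_of_nonneg _ _ hl]
      exact hmem ((m, k), n, l + 1)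
    · rw [mul_ipow_of_neg _ _ hl, h.D_star, one_mul]
      exact hmem ((m, k), n, l + 1)
  · refine mul_mono_mem h.star_a_b h.star_a_star_b _ m k n l ?_
    rw [← mul_assoc (star a)]
    -- Negating the exponent exchanges `a` and `star a`, so `star a` becomes the base of the integer
    -- power.
    obtain ⟨n, rfl⟩ : ∃ n', n = -n' := ⟨-n, (neg_neg n).symm⟩
    rw [ipow_neg]
    have h1 : ∀ m k, b ^ m * star b ^ k * (ipow (star a) a (n + 1) * ipow D (star D) l) ∈
        Submodule.span ℂ (Set.range (mono a b D)) := by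
      intro m k
      have := hmem ((m, k), -(n + 1), l)
      rwa [mono, ipow_neg] at this
    rcases le_or_gt 0 n with hn | hn
    · rw [mul_ipow_of_nonneg _ _ hn]
      exact h1 m k
    · rw [mul_ipow_of_neg _ _ hn, h.star_a_mul_self, sub_mul, sub_mul, one_mul, mul_sub,
        ← h.b_normal, smul_mul_assoc, smul_mul_assoc, mul_smul_comm, mul_assoc (b * star b),
        h.pow_mul_pow_mul]
      exact sub_mem (h1 m k) (Submodule.smul_mem _ _ (h1 (m + 1) (k + 1)))
  · rw [h.star_b_mul_mono]
    exact hmem _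
  · refine mul_mono_mem h.star_D_b (h.star_D_star_b hq) _ m k n l ?_
    have h1 : star D * ipow a (star a) n = ipow a (star a) n * star D := by
      have := ipow_mul_eq_smul (c := 1) (u := a) (v := star a) (w := star D)
        (by rw [one_smul]; simpa using congrArg star h.D_star_a)
        (by rw [inv_one, one_smul, ← star_mul, ← star_mul, h.a_D]) n
      rw [this, one_zpow, one_smul]
    rw [← mul_assoc (star D), h1, mul_assoc (ipow a (star a) n)]
    obtain ⟨l, rfl⟩ : ∃ l', l = -l' := ⟨-l, (neg_neg l).symm⟩
    have h2 := hmem ((m, k), n, -(l + 1))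
    rw [mono, ipow_neg D] at h2
    rw [ipow_neg]
    rcases le_or_gt 0 l with hl | hl
    · rwa [mul_ipow_of_nonneg _ _ hl]
    · rwa [mul_ipow_of_neg _ _ hl, h.star_D, one_mul]

theorem mem_span_mono (h : UqTwoRel q a b D) (hq : q ≠ 0) {x : A}
    (hx : x ∈ StarAlgebra.adjoin ℂ {a, b, D}) :
    x ∈ Submodule.span ℂ (Set.range (mono a b D)) := by
  have hone : (1 : A) ∈ Submodule.span ℂ (Set.range (mono a b D)) :=
    Submodule.subset_span ⟨((0, 0), 0, 0), by simp [mono, ipow_zero]⟩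
  have hmul : ∀ u ∈ ({a, b, D} : Set A) ∪ star {a, b, D},
      ∀ y ∈ Submodule.span ℂ (Set.range (mono a b D)),
        u * y ∈ Submodule.span ℂ (Set.range (mono a b D)) := by
    intro u hu y hy
    induction hy using Submodule.span_induction with
    | mem y hy =>
      obtain ⟨p, rfl⟩ := hy
      exact h.mul_mono_mem_span hq hu p
    | zero => simp
    | add y z _ _ hy hz => rw [mul_add]; exact add_mem hy hz
    | smul c y _ hy => rw [mul_smul_comm]; exact Submodule.smul_mem _ c hy
  have hx' : x ∈ Algebra.adjoin ℂ (({a, b, D} : Set A) ∪ star {a, b, D}) := hx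
  -- Stability under left multiplication by x, unlike mere membership, passes to products.
  suffices ∀ y ∈ Submodule.span ℂ (Set.range (mono a b D)),
      x * y ∈ Submodule.span ℂ (Set.range (mono a b D)) by simpa using this 1 hone
  clear hx
  induction hx' using Algebra.adjoin_induction with
  | mem u hu => exact hmul u hu
  | algebraMap c =>
    intro y hy
    rw [← Algebra.smul_def]
    exact Submodule.smul_mem _ c hy
  | add y z _ _ hy hz =>
    intro w hw
    rw [add_mul]
    exact add_mem (hy w hw) (hz w hw)
  | mul y z _ _ hy hz =>
    intro w hw
    rw [mul_assoc]
    exact hy _ (hz w hw)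

/-- Once the ordered monomials are linearly independent, an element of the generated `*`-algebra
which commutes with `a` and `b` is a scalar. -/
theorem mem_range_algebraMap_of_commute (h : UqTwoRel q a b D) (hq0 : q ≠ 0) (hq1 : ‖q‖ ≠ 1)
    (hω : ∀ l : ℤ, phase q ^ l = 1 → l = 0) (hM : LinearIndependent ℂ (mono a b D)) {x : A}
    (hx : x ∈ StarAlgebra.adjoin ℂ {a, b, D}) (ha : Commute x a) (hb : Commute x b) :
    x ∈ Set.range (algebraMap ℂ A) := by
  obtain ⟨c, rfl⟩ := (Finsupp.mem_span_range_iff_exists_finsupp).1 (h.mem_span_mono hq0 hx)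
  change Commute (Finsupp.linearCombination ℂ (mono a b D) c) a at ha
  change Commute (Finsupp.linearCombination ℂ (mono a b D) c) b at hb
  have hn0 : 0 < ‖q‖ := norm_pos_iff.2 hq0
  have h1 : ∀ p ∈ c.support, p.2 = 0 := by
    intro p hp
    -- Multiplication by b raises m from either side; the scalars are 1 on the left and q^(-n)
    -- phase^(-l) on the right.
    have := hM.eq_of_commute (ρ := fun p => ((p.1.1 + 1, p.1.2), p.2))
      (by rintro ⟨⟨m, k⟩, n, l⟩ ⟨⟨m', k'⟩, n', l'⟩; simp) (l := fun _ => 1)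
      (fun p _ => (b_mul_mono a b D p.1.1 p.1.2 p.2.1 p.2.2).trans (one_smul ℂ _).symm)
      (fun p _ => h.mono_mul_b hq0 p.1.1 p.1.2 p.2.1 p.2.2) hb hp
    -- The phase has modulus one, so norms see only n.
    have h2 : ‖q‖ ^ p.2.1 = 1 := by
      have := congrArg norm this
      simpa [norm_phase hq0, eq_comm] using this
    have hn : p.2.1 = 0 :=
      (zpow_right_injective₀ hn0 hq1 (by simpa using h2 : ‖q‖ ^ p.2.1 = ‖q‖ ^ (0 : ℤ)))
    have hl : p.2.2 = 0 := hω _ (by simpa [hn, eq_comm] using this)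
    exact Prod.ext hn hl
  have h2 : ∀ p ∈ c.support, p = 0 := by
    intro p hp
    -- With n = l = 0 known, multiplication by a gives the same monomial from both sides, with
    -- scalars (q^m q̄^k)⁻¹ and 1.
    have := hM.eq_of_commute (ρ := fun p => (p.1, p.2.1 + 1, p.2.2))
      (by rintro ⟨⟨m, k⟩, n, l⟩ ⟨⟨m', k'⟩, n', l'⟩; simp)
      (l := fun p => (q ^ p.1.1 * star q ^ p.1.2)⁻¹) (r := fun _ => 1)
      (fun p hp => by
        obtain ⟨⟨m, k⟩, n, l⟩ := p
        cases h1 _ hp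
        exact h.a_mul_mono_zero hq0 m k)
      (fun p hp => by
        obtain ⟨⟨m, k⟩, n, l⟩ := p
        cases h1 _ hp
        exact (mono_mul_a a b D m k).trans (one_smul ℂ _).symm) ha hp
    exact Prod.ext (injective_pow_mul_conj_pow hq0 hq1 hω (a₂ := (0, 0))
      (by simpa using inv_eq_one.1 this)) (h1 p hp)
  refine ⟨c 0, ?_⟩
  rw [Finsupp.sum, Finset.sum_subset (s₂ := {0}) (fun p hp => by simpa using h2 p hp)
    (fun p _ hp => by rw [Finsupp.notMem_support_iff.1 hp, zero_smul]), Finset.sum_singleton,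
    Algebra.algebraMap_eq_smul_one]
  congr 1
  exact (by simp [mono, ipow_zero] : mono a b D ((0, 0), 0, 0) = 1).symm

end UqTwoRel

/-! ### The realisation on ℓ²(ℕ × ℤ) for 0 < |q| < 1. -/

namespace UqTwo

/-- The weight of the raising operator into level `N`. -/
noncomputable def wt (q : ℂ) (N : ℕ) : ℂ := (Real.sqrt (1 - ‖q‖ ^ (2 * N)) : ℝ)

section weights

variable {q : ℂ}

theorem wt_zero (q : ℂ) : wt q 0 = 0 := by simp [wt]

theorem wt_ne_zero (hq : ‖q‖ < 1) {N : ℕ} (hN : N ≠ 0) : wt q N ≠ 0 := by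
  have h : ‖q‖ ^ (2 * N) < 1 := pow_lt_one₀ (norm_nonneg q) hq (by omega)
  rw [wt, Complex.ofReal_ne_zero]
  exact (Real.sqrt_pos.2 (by linarith)).ne'

theorem wt_mul_self (hq : ‖q‖ < 1) (N : ℕ) : wt q N * wt q N = 1 - q ^ N * star q ^ N := by
  have h : ‖q‖ ^ (2 * N) ≤ 1 := pow_le_one₀ (norm_nonneg q) hq.le
  rw [wt, ← Complex.ofReal_mul, Real.mul_self_sqrt (by linarith), ← mul_pow, Complex.star_def,
    Complex.mul_conj']
  push_cast
  rw [pow_mul]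

theorem star_wt (q : ℂ) (N : ℕ) : star (wt q N) = wt q N := Complex.conj_ofReal _

theorem norm_wt_le_one (q : ℂ) (N : ℕ) : ‖wt q N‖ ≤ 1 := by
  rw [wt, Complex.norm_real, Real.norm_of_nonneg (Real.sqrt_nonneg _), Real.sqrt_le_iff]
  refine ⟨zero_le_one, ?_⟩
  linarith [pow_nonneg (norm_nonneg q) (2 * N)]

/-- The eigenvalues of the operator representing `b`. -/
noncomputable def bEigen (q : ℂ) (i : ℕ × ℤ) : ℂ := q ^ i.1 * phase q ^ i.2

theorem norm_bEigen_le_one (hq0 : q ≠ 0) (hq : ‖q‖ < 1) (i : ℕ × ℤ) : ‖bEigen q i‖ ≤ 1 := by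
  rw [bEigen, norm_mul, norm_zpow, norm_phase hq0, one_zpow, mul_one, norm_pow]
  exact pow_le_one₀ (norm_nonneg q) hq.le

end weights

/-- The operator representing `a` on `ℓ²(ℕ × ℤ)`. -/
noncomputable def aOp (q : ℂ) :
    lp (fun _ : ℕ × ℤ => ℂ) 2 →L[ℂ] lp (fun _ : ℕ × ℤ => ℂ) 2 :=
  weightedComp (fun i => wt q i.1) (fun i => (i.1 - 1, i.2)) (fun i => norm_wt_le_one q i.1) <| by
    rintro ⟨N, L⟩ h ⟨N', L'⟩ h' e
    -- Truncated subtraction identifies levels 0 and 1; the zero weight at level 0 excludes the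
    -- collision.
    have h1 : N ≠ 0 := by rintro rfl; exact h (wt_zero q)
    have h2 : N' ≠ 0 := by rintro rfl; exact h' (wt_zero q)
    simp only [Prod.mk.injEq] at e ⊢
    omega

/-- The operator representing `b` on `ℓ²(ℕ × ℤ)`. -/
noncomputable def bOp {q : ℂ} (hq0 : q ≠ 0) (hq : ‖q‖ < 1) :
    lp (fun _ : ℕ × ℤ => ℂ) 2 →L[ℂ] lp (fun _ : ℕ × ℤ => ℂ) 2 :=
  weightedComp (bEigen q) id (norm_bEigen_le_one hq0 hq) Function.injective_id.injOn

/-- The operator representing `D` on `ℓ²(ℕ × ℤ)`. -/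
noncomputable def DOp : lp (fun _ : ℕ × ℤ => ℂ) 2 →L[ℂ] lp (fun _ : ℕ × ℤ => ℂ) 2 :=
  weightedComp (fun _ => 1) (fun i => (i.1, i.2 - 1)) (fun _ => by simp) <| by
    rintro ⟨N, L⟩ _ ⟨N', L'⟩ _ e
    simp only [Prod.mk.injEq] at e ⊢
    omega

section operators

variable {q : ℂ} (hq0 : q ≠ 0) (hq : ‖q‖ < 1) (y : lp (fun _ : ℕ × ℤ => ℂ) 2) (N : ℕ) (L : ℤ)

theorem aOp_apply : aOp q y (N, L) = wt q N * y (N - 1, L) := rfl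

theorem bOp_apply : bOp hq0 hq y (N, L) = bEigen q (N, L) * y (N, L) := rfl

theorem DOp_apply : DOp y (N, L) = y (N, L - 1) := one_mul _

theorem star_aOp_apply : star (aOp q) y (N, L) = wt q (N + 1) * y (N + 1, L) := by
  have h : star (aOp q) = weightedComp (fun i => wt q (i.1 + 1)) (fun i => (i.1 + 1, i.2))
      (fun i => norm_wt_le_one q _)
      (by
        rintro ⟨N, L⟩ _ ⟨N', L'⟩ _ e
        simp only [Prod.mk.injEq] at e ⊢
        omega) := by
    refine star_weightedComp ?_
    rintro ⟨N, L⟩ ⟨N', L'⟩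
    simp only [star_wt, Prod.mk.injEq]
    rcases N' with _ | N'
    · simp [wt_zero]
    · by_cases h1 : N' = N ∧ L' = L
      · obtain ⟨rfl, rfl⟩ := h1
        simp
      · rw [if_neg (by simpa using h1), if_neg]
        rintro ⟨h2, h3⟩
        exact h1 ⟨by omega, h3.symm⟩
  rw [h]
  rfl

theorem star_bOp_apply :
    star (bOp hq0 hq) y (N, L) = star (bEigen q (N, L)) * y (N, L) := by
  have h : star (bOp hq0 hq) = weightedComp (fun i => star (bEigen q i)) id
      (fun i => (norm_star _).trans_le (norm_bEigen_le_one hq0 hq i))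
      Function.injective_id.injOn := by
    refine star_weightedComp fun i j => ?_
    by_cases h : j = i
    · simp [h]
    · simp [h, Ne.symm h]
  rw [h, weightedComp_apply]
  rfl

theorem star_DOp_apply : star DOp y (N, L) = y (N, L + 1) := by
  have h : star DOp = weightedComp (fun _ => 1) (fun i : ℕ × ℤ => (i.1, i.2 + 1))
      (fun _ => by simp)
      (by
        rintro ⟨N, L⟩ _ ⟨N', L'⟩ _ e
        simp only [Prod.mk.injEq] at e ⊢
        omega) := by
    refine star_weightedComp ?_
    rintro ⟨N, L⟩ ⟨N', L'⟩
    simp only [star_one, Prod.mk.injEq]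
    congr 1
    apply propext
    omega
  rw [h]
  exact one_mul _

/-- All relations are checked coordinatewise. The weights are chosen so that wt(N)² + |q|^(2N) = 1:
at level N this is `row`, at level N + 1 it is `col`. -/
theorem uqTwoRel_op : UqTwoRel q (aOp q) (bOp hq0 hq) DOp := by
  have hω := phase_ne_zero hq0
  have hs : star (phase q) = (phase q)⁻¹ := star_phase hq0
  have hbb : ∀ N L, bEigen q (N, L) * star (bEigen q (N, L)) = q ^ N * star q ^ N := by
    intro N L
    simp only [bEigen, star_mul', star_pow, star_zpow₀, hs, inv_zpow]
    field_simp
  constructor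
  · ext y ⟨N, L⟩
    change bOp hq0 hq (aOp q y) (N, L) = q * aOp q (bOp hq0 hq y) (N, L)
    rw [bOp_apply, aOp_apply, aOp_apply, bOp_apply]
    rcases N with _ | N
    · simp [wt_zero]
    · simp only [bEigen, Nat.add_sub_cancel, pow_succ]
      ring
  · ext y ⟨N, L⟩
    change star (aOp q) (bOp hq0 hq y) (N, L) = q * bOp hq0 hq (star (aOp q) y) (N, L)
    rw [bOp_apply, star_aOp_apply, star_aOp_apply, bOp_apply]
    simp only [bEigen, pow_succ]
    ring
  · ext y ⟨N, L⟩
    change bOp hq0 hq (star (bOp hq0 hq) y) (N, L) = star (bOp hq0 hq) (bOp hq0 hq y) (N, L)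
    rw [bOp_apply, star_bOp_apply, star_bOp_apply, bOp_apply]
    ring
  · ext y ⟨N, L⟩
    change aOp q (star (aOp q) y) (N, L) + bOp hq0 hq (star (bOp hq0 hq) y) (N, L) = y (N, L)
    rw [bOp_apply, star_bOp_apply, aOp_apply, star_aOp_apply, ← mul_assoc, ← mul_assoc, hbb]
    rcases N with _ | N
    · simp [wt_zero]
    · rw [Nat.add_sub_cancel, wt_mul_self hq]
      ring
  · ext y ⟨N, L⟩
    change aOp q (DOp y) (N, L) = DOp (aOp q y) (N, L)
    rw [aOp_apply, DOp_apply, DOp_apply, aOp_apply]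
  · ext y ⟨N, L⟩
    change bOp hq0 hq (DOp y) (N, L) = phase q * DOp (bOp hq0 hq y) (N, L)
    rw [bOp_apply, DOp_apply, DOp_apply, bOp_apply]
    simp only [bEigen, zpow_sub_one₀ hω]
    field_simp
  · ext y ⟨N, L⟩
    change DOp (star DOp y) (N, L) = y (N, L)
    rw [DOp_apply, star_DOp_apply, sub_add_cancel]
  · ext y ⟨N, L⟩
    change star DOp (DOp y) (N, L) = y (N, L)
    rw [star_DOp_apply, DOp_apply, add_sub_cancel_right]
  · ext y ⟨N, L⟩
    change star (aOp q) (aOp q y) (N, L) +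
      (‖q‖ : ℂ) ^ 2 * star (bOp hq0 hq) (bOp hq0 hq y) (N, L) = y (N, L)
    rw [star_bOp_apply, bOp_apply, star_aOp_apply, aOp_apply, Nat.add_sub_cancel, ← mul_assoc,
      ← mul_assoc (star _), mul_comm (star _), hbb, wt_mul_self hq, ← Complex.mul_conj',
      ← Complex.star_def]
    ring

/-- The realisation of the relations on `ℓ²(ℕ × ℤ)` for `0 < |q| < 1`. -/
noncomputable def opRep : UqTwoRep q :=
  haveI : Nontrivial (lp (fun _ : ℕ × ℤ => ℂ) 2) :=
    ⟨lp.single 2 0 1, 0, fun h => by simpa using congrArg (fun y => y 0) h⟩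
  { carrier := lp (fun _ : ℕ × ℤ => ℂ) 2 →L[ℂ] lp (fun _ : ℕ × ℤ => ℂ) 2
    a := aOp q
    b := bOp hq0 hq
    D := DOp
    rel := uqTwoRel_op hq0 hq }

/-- The scalar is a product of weights at positive levels, none of which vanishes. -/
theorem exists_ipow_aOp_apply (hq : ‖q‖ < 1) (n : ℤ) (N N' : ℕ) (h : (N' : ℤ) = N + n) :
    ∃ c : ℂ, c ≠ 0 ∧ ∀ y L, ipow (aOp q) (star (aOp q)) n y (N', L) = c * y (N, L) := by
  have hup : ∀ n N : ℕ, ∃ c : ℂ, c ≠ 0 ∧ ∀ y L, (aOp q ^ n) y (N + n, L) = c * y (N, L) := by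
    intro n N
    induction n with
    | zero => exact ⟨1, one_ne_zero, fun y L => (one_mul _).symm⟩
    | succ n ih =>
      obtain ⟨c, hc, ih⟩ := ih
      refine ⟨wt q (N + (n + 1)) * c, mul_ne_zero (wt_ne_zero hq (by omega)) hc, fun y L => ?_⟩
      rw [pow_succ', mul_apply_eq_comp, aOp_apply, ← add_assoc, Nat.add_sub_cancel, ih,
        mul_assoc]
  have hdown : ∀ n N : ℕ, ∃ c : ℂ, c ≠ 0 ∧
      ∀ y L, (star (aOp q) ^ n) y (N, L) = c * y (N + n, L) := by
    intro n
    induction n with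
    | zero => exact fun N => ⟨1, one_ne_zero, fun y L => (one_mul _).symm⟩
    | succ n ih =>
      intro N
      obtain ⟨c, hc, ih⟩ := ih (N + 1)
      refine ⟨wt q (N + 1) * c, mul_ne_zero (wt_ne_zero hq (by omega)) hc, fun y L => ?_⟩
      rw [pow_succ', mul_apply_eq_comp, star_aOp_apply, ih, mul_assoc, add_right_comm,
        add_assoc]
  rcases n with n | n
  · obtain rfl : N' = N + n := by
      rw [Int.ofNat_eq_natCast] at h
      omega
    exact hup n N
  · obtain rfl : N = N' + (n + 1) := by omega
    exact hdown (n + 1) N'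

/-- Unwinding the raising operators from a level below n meets the weight `wt q 0 = 0`. -/
theorem ipow_aOp_apply_of_lt (n : ℤ) (h : (N : ℤ) < n) :
    ipow (aOp q) (star (aOp q)) n y (N, L) = 0 := by
  obtain ⟨n, rfl⟩ := Int.eq_ofNat_of_zero_le (by omega : 0 ≤ n)
  change (aOp q ^ n) y (N, L) = 0
  have hn : N < n := by omega
  clear h
  induction n generalizing N with
  | zero => omega
  | succ n ih =>
    rw [pow_succ', mul_apply_eq_comp, aOp_apply]
    rcases N with _ | N
    · rw [wt_zero, zero_mul]
    · rw [ih _ (by omega), mul_zero]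

theorem ipow_DOp_apply (l : ℤ) : ipow DOp (star DOp) l y (N, L) = y (N, L - l) := by
  have hup : ∀ (k : ℕ) (L : ℤ), (DOp ^ k) y (N, L) = y (N, L - k) := by
    intro k
    induction k with
    | zero => simp
    | succ k ih =>
      intro L
      rw [pow_succ', mul_apply_eq_comp, DOp_apply, ih, sub_sub, add_comm 1, Nat.cast_succ]
  have hdown : ∀ (k : ℕ) (L : ℤ), (star DOp ^ k) y (N, L) = y (N, L + k) := by
    intro k
    induction k with
    | zero => simp
    | succ k ih =>
      intro L
      rw [pow_succ', mul_apply_eq_comp, star_DOp_apply, ih, add_assoc, add_comm 1,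
        Nat.cast_succ]
  rcases l with l | l
  · exact hup l L
  · rw [Int.negSucc_eq, sub_neg_eq_add, ← Nat.cast_succ]
    exact hdown (l + 1) L

theorem pow_bOp_apply (m k : ℕ) :
    (bOp hq0 hq ^ m * star (bOp hq0 hq) ^ k) y (N, L) =
      bEigen q (N, L) ^ m * star (bEigen q (N, L)) ^ k * y (N, L) := by
  induction m with
  | zero =>
    induction k with
    | zero => simp
    | succ k ih =>
      rw [pow_zero, one_mul] at ih ⊢
      rw [pow_succ', mul_apply_eq_comp, star_bOp_apply, ih, pow_succ]
      ring
  | succ m ih =>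
    rw [pow_succ', mul_assoc, mul_apply_eq_comp, bOp_apply, ih, pow_succ]
    ring

theorem linearIndependent_mono_op (hω : ∀ l : ℤ, phase q ^ l = 1 → l = 0) :
    LinearIndependent ℂ (mono (aOp q) (bOp hq0 hq) DOp) := by
  rw [linearIndependent_iff']
  rintro s c hsum ⟨p₀, n₀, l₀⟩ hp₀
  have hq1 : ‖q‖ ≠ 1 := hq.ne
  have hcoef : ∀ t : ℕ, ∑ p ∈ s with p.2 = (n₀, l₀),
      c p * (bEigen q (t + n₀.toNat, l₀) ^ p.1.1 * star (bEigen q (t + n₀.toNat, l₀)) ^ p.1.2) =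
        0 := by
    intro t
    -- The levels t + n₀⁻ and t + n₀⁺ are natural numbers differing by n₀. The matrix coefficient
    -- from (t + n₀⁻, 0) to (t + n₀⁺, l₀) sees only the monomials with (n, l) = (n₀, l₀).
    obtain ⟨w, hw, hw'⟩ := exists_ipow_aOp_apply hq n₀ (t + (-n₀).toNat) (t + n₀.toNat)
      (by push_cast; omega)
    refine (mul_eq_zero.1 ?_).resolve_right hw
    rw [Finset.sum_filter, Finset.sum_mul]
    have := congrArg (fun T : lp (fun _ : ℕ × ℤ => ℂ) 2 →L[ℂ] lp (fun _ : ℕ × ℤ => ℂ) 2 =>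
      T (lp.single 2 (t + (-n₀).toNat, 0) 1) (t + n₀.toNat, l₀)) hsum
    simp only [sum_apply, lp.coeFn_sum, Finset.sum_apply,
      smul_apply, lp.coeFn_smul, Pi.smul_apply, smul_eq_mul,
      zero_apply, lp.coeFn_zero, Pi.zero_apply] at this
    refine Eq.trans ?_ this
    refine Finset.sum_congr rfl ?_
    rintro ⟨⟨m, k⟩, n, l⟩ _
    rw [mono, mul_apply_eq_comp, pow_bOp_apply, mul_apply_eq_comp]
    by_cases hnl : (n, l) = (n₀, l₀)
    · cases hnl
      rw [if_pos rfl, hw', ipow_DOp_apply]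
      simp [mul_assoc]
    · rw [if_neg hnl, zero_mul]
      suffices h0 : ipow (aOp q) (star (aOp q)) n (ipow DOp (star DOp) l
          (lp.single 2 (t + (-n₀).toNat, 0) 1)) (t + n₀.toNat, l₀) = 0 by
        rw [h0, mul_zero, mul_zero]
      rcases lt_or_ge ((t + n₀.toNat : ℕ) : ℤ) n with hn | hn
      · exact ipow_aOp_apply_of_lt _ _ _ _ hn
      · obtain ⟨w', -, h'⟩ := exists_ipow_aOp_apply hq n ((t + n₀.toNat : ℕ) - n).toNat
          (t + n₀.toNat) (by omega)
        rw [h', ipow_DOp_apply, lp.single_apply_ne, mul_zero]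
        intro e
        simp only [Prod.mk.injEq] at e hnl
        omega
  have hinj : Set.InjOn (fun p : (ℕ × ℕ) × ℤ × ℤ => q ^ p.1.1 * star q ^ p.1.2)
      (s.filter fun p => p.2 = (n₀, l₀)) := by
    intro p hp p' hp' e
    refine Prod.ext (injective_pow_mul_conj_pow hq0 hq1 hω e) ?_
    rw [(Finset.mem_filter.1 hp).2, (Finset.mem_filter.1 hp').2]
  have hβ : bEigen q (n₀.toNat, l₀) ≠ 0 :=
    mul_ne_zero (pow_ne_zero _ hq0) (zpow_ne_zero _ (phase_ne_zero hq0))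
  -- The eigenvalue of b at level t + n₀⁺ is q^t times the one at n₀⁺, so each term is geometric in
  -- t with ratio q^m q̄^k.
  have hfin := eq_zero_of_forall_sum_mul_pow_eq_zero hinj (c := fun p => c p *
      (bEigen q (n₀.toNat, l₀) ^ p.1.1 * star (bEigen q (n₀.toNat, l₀)) ^ p.1.2))
    (fun t => by
      rw [← hcoef t]
      refine Finset.sum_congr rfl fun p _ => ?_
      have : bEigen q (t + n₀.toNat, l₀) = q ^ t * bEigen q (n₀.toNat, l₀) := by
        simp only [bEigen]
        ring
      rw [this, star_mul', star_pow]
      ring) (Finset.mem_filter.2 ⟨hp₀, rfl⟩)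
  refine (mul_eq_zero.1 hfin).resolve_right ?_
  exact mul_ne_zero (pow_ne_zero _ hβ) (pow_ne_zero _ (star_ne_zero.2 hβ))

end operators

end UqTwo

/-! ### Exchanging q and q⁻¹. -/

/-- Passing to `(a*, q b, D*)` exchanges the parameters `q` and `q⁻¹`. -/
theorem UqTwoRel.inv {q : ℂ} {A : Type*} [Ring A] [StarRing A] [Algebra ℂ A] [StarModule ℂ A]
    {a b D : A} (h : UqTwoRel q a b D) (hq : q ≠ 0) :
    UqTwoRel q⁻¹ (star a) (q • b) (star D) := by
  have hc : q * star q = (‖q‖ : ℂ) ^ 2 := Complex.mul_conj' q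
  have hc0 : (‖q‖ : ℂ) ^ 2 ≠ 0 := pow_ne_zero 2 (by exact_mod_cast norm_ne_zero_iff.2 hq)
  have hphase : UqTwo.phase q⁻¹ = (UqTwo.phase q)⁻¹ := UqTwo.phase_inv q
  constructor
  · rw [mul_smul_comm, h.star_a_b, smul_mul_assoc, smul_smul, smul_smul, inv_mul_cancel₀ hq, one_mul]
  · rw [star_star, mul_smul_comm, h.a_b hq, smul_mul_assoc, smul_comm]
  · simp only [star_smul, smul_mul_smul_comm, h.b_normal, mul_comm]
  · rw [star_star, star_smul, smul_mul_smul_comm, hc, h.b_normal, h.col]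
  · rw [← star_mul, ← star_mul, h.a_D]
  · change q • b * star D = UqTwo.phase q⁻¹ • (star D * (q • b))
    rw [mul_smul_comm, h.star_D_b, smul_mul_assoc, hphase, smul_comm q, smul_smul,
      inv_mul_cancel₀ (UqTwo.phase_ne_zero hq), one_smul]
  · rw [star_star, h.star_D]
  · rw [star_star, h.D_star]
  · rw [star_star, star_smul, smul_mul_smul_comm, mul_comm (star q), hc, smul_smul, norm_inv]
    push_cast
    rw [inv_pow, inv_mul_cancel₀ hc0, one_smul, ← h.b_normal, h.row]

/-! ### The center of 𝒪(U_q(2)). -/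

namespace UqTwo

variable {q : ℂ}

theorem linearIndependent_mono_of_map {A B : Type*} [Ring A] [StarRing A] [Algebra ℂ A] [Ring B]
    [StarRing B] [Algebra ℂ B] (f : A →⋆ₐ[ℂ] B) {a b D : A}
    (h : LinearIndependent ℂ (mono (f a) (f b) (f D))) : LinearIndependent ℂ (mono a b D) := by
  refine LinearIndependent.of_comp f.toAlgHom.toLinearMap ?_
  convert h using 1
  exact funext fun p => map_mono f a b D p

/-- For |q| > 1 the argument runs in the generators (a*, q b, D*) with parameter q⁻¹; commutation
with `star (a q)` then replaces commutation with `a q`. -/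
theorem mem_range_algebraMap_of_commute (hq0 : q ≠ 0) (hq1 : ‖q‖ ≠ 1)
    (hω : ∀ l : ℤ, phase q ^ l = 1 → l = 0) {x : CU q} (hx : x ∈ O q) (ha : Commute x (a q))
    (hsa : Commute x (star (a q))) (hb : Commute x (b q)) :
    x ∈ Set.range (algebraMap ℂ (CU q)) := by
  rcases hq1.lt_or_gt with hq | hq
  · exact (rel q).mem_range_algebraMap_of_commute hq0 hq1 hω
      (linearIndependent_mono_of_map (toRep q (opRep hq0 hq))
        (linearIndependent_mono_op hq0 hq hω)) hx ha hb
  · have hq0' : q⁻¹ ≠ 0 := inv_ne_zero hq0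
    have hq' : ‖q⁻¹‖ < 1 := by
      rw [norm_inv]
      exact inv_lt_one_of_one_lt₀ hq
    have hω' : ∀ l : ℤ, phase q⁻¹ ^ l = 1 → l = 0 := fun l hl =>
      hω l (by rwa [phase_inv, inv_zpow, inv_eq_one] at hl)
    have hrep := (uqTwoRel_op hq0' hq').inv hq0'
    rw [inv_inv] at hrep
    -- Inverting the operators for q⁻¹ gives a realisation for q, in which a*, q b and D* become the
    -- original operators.
    let π : UqTwoRep q :=
      { carrier := (opRep hq0' hq').carrier
        a := star (aOp q⁻¹)
        b := q⁻¹ • bOp hq0' hq'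
        D := star DOp
        rel := hrep }
    have hM : LinearIndependent ℂ (mono (star (a q)) (q • b q) (star (D q))) := by
      refine linearIndependent_mono_of_map (toRep q π) ?_
      have h1 : toRep q π (star (a q)) = aOp q⁻¹ := star_star (aOp q⁻¹)
      have h2 : toRep q π (q • b q) = bOp hq0' hq' := smul_inv_smul₀ hq0 (bOp hq0' hq')
      have h3 : toRep q π (star (D q)) = DOp := star_star DOp
      rw [h1, h2, h3]
      exact linearIndependent_mono_op hq0' hq' hω'
    refine ((rel q).inv hq0).mem_range_algebraMap_of_commute hq0' hq'.ne hω' hM ?_ hsa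
      (hb.smul_right q)
    refine StarAlgebra.adjoin_le (S := StarAlgebra.adjoin ℂ _) ?_ hx
    have hsub := StarAlgebra.subset_adjoin ℂ ({star (a q), q • b q, star (D q)} : Set (CU q))
    rintro y (rfl | rfl | rfl)
    · have := star_mem (hsub (Set.mem_insert _ _))
      rwa [star_star] at this
    · have := (StarAlgebra.adjoin ℂ _).smul_mem (hsub (Set.mem_insert_of_mem _ (Set.mem_insert _ _))) q⁻¹
      rwa [inv_smul_smul₀ hq0] at this
    · have := star_mem (hsub (Set.mem_insert_of_mem _ (Set.mem_insert_of_mem _ rfl)))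
      rwa [star_star] at this

theorem center_O_eq_bot (hq0 : q ≠ 0) (hq1 : ‖q‖ ≠ 1)
    (hω : ∀ l : ℤ, phase q ^ l = 1 → l = 0) : Subalgebra.center ℂ (O q) = ⊥ := by
  rw [eq_bot_iff]
  intro x hx
  have hcomm : ∀ y ∈ O q, Commute (x : CU q) y := fun y hy =>
    (congrArg Subtype.val (Subalgebra.mem_center_iff.1 hx ⟨y, hy⟩)).symm
  have ha : a q ∈ O q := StarAlgebra.subset_adjoin ℂ _ (by simp)
  have hb : b q ∈ O q := StarAlgebra.subset_adjoin ℂ _ (by simp)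
  obtain ⟨c, hc⟩ := mem_range_algebraMap_of_commute hq0 hq1 hω x.2 (hcomm _ ha)
    (hcomm _ (star_mem ha)) (hcomm _ hb)
  exact ⟨c, Subtype.ext hc⟩

/-- The one-dimensional realisation with `a = 1`, `b = 0` and `D = u`. -/
noncomputable def scalarRep (q u : ℂ) (hu : u * star u = 1) : UqTwoRep q where
  carrier := ℂ
  a := 1
  b := 0
  D := u
  rel := by constructor <;> first | exact hu | exact (mul_comm _ _).trans hu | simp

/-- A scalar has the same value in all one-dimensional realisations, whereas D takes both values 1
and -1. -/
theorem DO_notMem_bot (q : ℂ) : DO q ∉ (⊥ : Subalgebra ℂ (O q)) := by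
  rintro ⟨c, hc⟩
  have key : ∀ u (hu : u * star u = 1), c = u := fun u hu =>
    congrArg (fun y : O q => toRep q (scalarRep q u hu) y) hc
  have h := (key 1 (by simp)).symm.trans (key (-1) (by simp))
  norm_num at h

theorem DO_mem_center (hq0 : q ≠ 0) (hω : phase q = 1) :
    DO q ∈ Subalgebra.center ℂ (O q) := by
  have h := rel q
  rw [Subalgebra.mem_center_iff]
  rintro ⟨y, hy⟩
  refine Subtype.ext ?_
  change y * D q = D q * y
  have hy' : y ∈ Algebra.adjoin ℂ (({a q, b q, D q} : Set (CU q)) ∪ star {a q, b q, D q}) := hy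
  suffices hle : (({a q, b q, D q} : Set (CU q)) ∪ star {a q, b q, D q}) ⊆
      Subalgebra.centralizer ℂ {D q} by
    exact (Subalgebra.mem_centralizer_iff ℂ).1 (Algebra.adjoin_le hle hy') (D q) rfl |>.symm
  intro u hu
  rw [SetLike.mem_coe, Subalgebra.mem_centralizer_iff]
  rintro _ rfl
  rcases eq_of_mem_union_star hu with rfl | rfl | rfl | rfl | rfl | rfl
  · exact h.a_D.symm
  · rw [h.D_b hq0, hω, inv_one, one_smul]
  · rfl
  · exact h.D_star_a
  · rw [h.D_star_b hq0, hω, one_smul]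
  · rw [h.D_star, h.star_D]

/-- The center of a `*`-algebra is closed under `star`, so it contains D* along with D. -/
theorem adjoin_DO_le_center (hq0 : q ≠ 0) (hω : phase q = 1) :
    (StarAlgebra.adjoin ℂ {DO q}).toSubalgebra ≤ Subalgebra.center ℂ (O q) := by
  have hD := DO_mem_center hq0 hω
  rw [StarAlgebra.adjoin_toSubalgebra, Algebra.adjoin_le_iff, Set.star_singleton]
  rintro u (rfl | rfl)
  · exact hD
  · rw [SetLike.mem_coe, Subalgebra.mem_center_iff]
    intro y
    have := congrArg star (Subalgebra.mem_center_iff.1 hD (star y))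
    rw [star_mul, star_mul, star_star] at this
    exact this.symm

end UqTwo

theorem mainTheorem3 :
    (∀ q : ℂ, q.im ≠ 0 → ‖q‖ ≠ 1 → Irrational (Complex.arg q / Real.pi) →
      Subalgebra.center ℂ (UqTwo.O q) = ⊥) ∧
    (∀ q : ℝ, q ≠ 0 →
      (StarAlgebra.adjoin ℂ {UqTwo.DO (q : ℂ)}).toSubalgebra ≤
          Subalgebra.center ℂ (UqTwo.O (q : ℂ)) ∧
      StarAlgebra.adjoin ℂ {UqTwo.DO (q : ℂ)} ≠ ⊥ ∧
      Subalgebra.center ℂ (UqTwo.O (q : ℂ)) ≠ ⊥) := by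
  refine ⟨fun q him hq1 hθ => ?_, fun q hq => ?_⟩
  · have hq0 : q ≠ 0 := by
      rintro rfl
      exact him rfl
    exact UqTwo.center_O_eq_bot hq0 hq1 fun l => UqTwo.phase_zpow_eq_one hq0 hθ
  · have hq0 : (q : ℂ) ≠ 0 := by exact_mod_cast hq
    have hω := UqTwo.phase_ofReal hq
    refine ⟨UqTwo.adjoin_DO_le_center hq0 hω, fun h => ?_, fun h => ?_⟩
    · have hD := StarAlgebra.self_mem_adjoin_singleton ℂ (UqTwo.DO (q : ℂ))
      rw [h] at hD
      exact UqTwo.DO_notMem_bot _ hD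
    · exact UqTwo.DO_notMem_bot _ (h ▸ UqTwo.DO_mem_center hq0 hω)
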